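/- Let $\mathrm{Aff}=\{(a,b): a>0,\ b\in\mathbb{R}\}$ be the affine group with the law $(a,b)(a',b')=(aa',ab'+b)$, and let $\pi_2$ be its quasi-regular representation on $L^2(\mathbb{R})$ (complex-valued functions), $[\pi_2(a,b)f](x)=a^{-1/2}f\left(\frac{x-b}{a}\right)$. Let $H^2\subset L^2(\mathbb{R})$ be the Hardy space, that is, the set of those $f\in L^2(\mathbb{R})$ that are the boundary values of their own Cauchy integral $[\mathcal{C}f](x+iy)=\frac{1}{2\pi i}\int_{\mathbb{R}}\frac{f(t)}{t-(x+iy)}\,dt$, in the sense that $[\mathcal{C}f](\cdot+iy)\to f$ in $L^2(\mathbb{R})$ as $y\to 0^+$. Let $\mathcal{F}$ be the unitary Fourier transform on $L^2(\mathbb{R})$, $\hat f(\lambda)=\int_{\mathbb{R}}e^{-2\pi i\lambda x}f(x)\,dx$. Let $T:L^2(\mathbb{R})\to L^2(\mathbb{R})$ be a bounded linear operator such that $T\pi_2(g)=\pi_2(g)T$ for all $g\in\mathrm{Aff}$. Then there are constants $k_1,k_2\in\mathbb{C}$ such that $T=k_1 I_{H^2}\oplus k_2 I_{(H^2)^\perp}$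 with respect to the orthogonal decomposition $L^2(\mathbb{R})=H^2\oplus (H^2)^\perp$. Moreover, for any $k_1,k_2\in\mathbb{C}$, $T$ has this form with the constants $k_1,k_2$ if and only if $\mathcal{F}T\mathcal{F}^{-1}$ is the operator of multiplication by $k_1\chi_{(0,+\infty)}+k_2\chi_{(-\infty,0)}$. -/

import Mathlib

open MeasureTheory Filter Topology FourierTransform
open scoped ENNReal

noncomputable section

/-- The affine (`ax + b`) group: pairs `(a, b)` of real numbers with `a > 0`. -/
@[ext]
structure Aff where
  a : ℝ
  b : ℝ
  a_pos : 0 < a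

namespace Aff

instance : Mul Aff := ⟨fun g h => ⟨g.a * h.a, g.a * h.b + g.b, mul_pos g.a_pos h.a_pos⟩⟩

instance : One Aff := ⟨⟨1, 0, one_pos⟩⟩

instance : Inv Aff := ⟨fun g => ⟨g.a⁻¹, -(g.a⁻¹ * g.b), inv_pos.mpr g.a_pos⟩⟩

@[simp] theorem mul_a (g h : Aff) : (g * h).a = g.a * h.a := rfl
@[simp] theorem mul_b (g h : Aff) : (g * h).b = g.a * h.b + g.b := rfl
@[simp] theorem one_a : (1 : Aff).a = 1 := rfl
@[simp] theorem one_b : (1 : Aff).b = 0 := rfl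
@[simp] theorem inv_a (g : Aff) : g⁻¹.a = g.a⁻¹ := rfl
@[simp] theorem inv_b (g : Aff) : g⁻¹.b = -(g.a⁻¹ * g.b) := rfl

/-- The group law `(a, b) (a', b') = (a a', a b' + b)`. -/
instance : Group Aff :=
  Group.ofLeftAxioms
    (by intro x y z; ext <;> simp <;> ring)
    (by intro x; ext <;> simp)
    (by
      intro x
      have := x.a_pos.ne'
      ext <;> simp [this])

end Aff

/-- The Hilbert space `L²(ℝ)` of complex-valued functions, with Lebesgue measure. -/
abbrev L2R : Type := Lp ℂ 2 (volume : Measure ℝ)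

/-- The function `x ↦ a^(-1/2) f((x - b)/a)`. -/
def quasiRegularFun (g : Aff) (f : ℝ → ℂ) (x : ℝ) : ℂ :=
  ((g.a ^ (-(1 / 2) : ℝ) : ℝ) : ℂ) * f ((x - g.b) / g.a)

theorem map_volume_affine (g : Aff) :
    Measure.map (fun x : ℝ => (x - g.b) / g.a) volume = ENNReal.ofReal g.a • volume := by
  have h1 : (fun x : ℝ => (x - g.b) / g.a) = (fun x => x * g.a⁻¹) ∘ (fun x => x - g.b) := by
    funext x; simp [div_eq_mul_inv]
  rw [h1, ← Measure.map_map (by fun_prop) (by fun_prop),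
    (measurePreserving_sub_right (volume : Measure ℝ) g.b).map_eq,
    Real.map_volume_mul_right (inv_ne_zero g.a_pos.ne')]
  simp [abs_of_pos g.a_pos]

theorem quasiMeasurePreserving_affine (g : Aff) :
    Measure.QuasiMeasurePreserving (fun x : ℝ => (x - g.b) / g.a) volume volume :=
  ⟨by fun_prop, by rw [map_volume_affine]; exact Measure.smul_absolutelyContinuous⟩

theorem memLp_comp_affine (g : Aff) {f : ℝ → ℂ} (hf : MemLp f 2 volume) :
    MemLp (fun x : ℝ => f ((x - g.b) / g.a)) 2 volume := by
  have h : MemLp f 2 (Measure.map (fun x : ℝ => (x - g.b) / g.a) volume) := by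
    rw [map_volume_affine]; exact hf.smul_measure ENNReal.ofReal_ne_top
  exact h.comp_of_map (by fun_prop)

theorem memLp_quasiRegularFun (g : Aff) {f : ℝ → ℂ} (hf : MemLp f 2 volume) :
    MemLp (quasiRegularFun g f) 2 volume :=
  (memLp_comp_affine g hf).const_mul _

theorem eLpNorm_quasiRegularFun (g : Aff) {f : ℝ → ℂ} (hf : MemLp f 2 volume) :
    eLpNorm (quasiRegularFun g f) 2 volume = eLpNorm f 2 volume := by
  have h1 : quasiRegularFun g f = ((g.a ^ (-(1 / 2) : ℝ) : ℝ) : ℂ) •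
      (f ∘ fun x : ℝ => (x - g.b) / g.a) := by
    funext x; simp [quasiRegularFun]
  have hm : AEStronglyMeasurable f (Measure.map (fun x : ℝ => (x - g.b) / g.a) volume) := by
    rw [map_volume_affine]; exact hf.1.mono_ac Measure.smul_absolutelyContinuous
  rw [h1, eLpNorm_const_smul, ← eLpNorm_map_measure hm (by fun_prop), map_volume_affine,
    eLpNorm_smul_measure_of_ne_top (by norm_num), smul_eq_mul, ← mul_assoc]
  have ha := g.a_pos
  have h2 : ‖((g.a ^ (-(1 / 2) : ℝ) : ℝ) : ℂ)‖ₑ = ENNReal.ofReal (g.a ^ (-(1 / 2) : ℝ)) := by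
    rw [← ofReal_norm, Complex.norm_real, Real.norm_of_nonneg (by positivity)]
  rw [h2, ENNReal.ofReal_rpow_of_pos ha, ← ENNReal.ofReal_mul (by positivity),
    ← Real.rpow_add ha]
  simp

/-- The operator `π₂(a, b)` on `L²(ℝ)`: `[π₂(a, b) f](x) = a^(-1/2) f((x - b)/a)`. -/
def quasiRegularIsometry (g : Aff) : L2R →ₗᵢ[ℂ] L2R where
  toFun f := (memLp_quasiRegularFun g (Lp.memLp f)).toLp _
  map_add' f₁ f₂ := by
    rw [← MemLp.toLp_add]
    apply MemLp.toLp_congr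
    filter_upwards [(quasiMeasurePreserving_affine g).ae (Lp.coeFn_add f₁ f₂)] with x hx
    simp only [quasiRegularFun, Pi.add_apply] at hx ⊢
    rw [hx, mul_add]
  map_smul' c f := by
    rw [RingHom.id_apply, ← MemLp.toLp_const_smul]
    apply MemLp.toLp_congr
    filter_upwards [(quasiMeasurePreserving_affine g).ae (Lp.coeFn_smul c f)] with x hx
    simp only [quasiRegularFun, Pi.smul_apply, smul_eq_mul] at hx ⊢
    rw [hx]; ring
  norm_map' f := by
    change ‖(memLp_quasiRegularFun g (Lp.memLp f)).toLp _‖ = ‖f‖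
    rw [Lp.norm_toLp, eLpNorm_quasiRegularFun g (Lp.memLp f), Lp.norm_def]

theorem quasiRegularIsometry_ae (g : Aff) (f : L2R) :
    quasiRegularIsometry g f =ᵐ[volume] quasiRegularFun g f :=
  (memLp_quasiRegularFun g (Lp.memLp f)).coeFn_toLp

/-- The quasi-regular representation `π₂` of the affine group on `L²(ℝ)`. -/
def quasiRegular : Aff →* (L2R →L[ℂ] L2R) where
  toFun g := (quasiRegularIsometry g).toContinuousLinearMap
  map_one' := by
    ext1 f
    apply Lp.ext
    filter_upwards [quasiRegularIsometry_ae 1 f] with x hx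
    simpa [quasiRegularFun] using hx
  map_mul' g h := by
    ext1 f
    apply Lp.ext
    filter_upwards [quasiRegularIsometry_ae (g * h) f,
      quasiRegularIsometry_ae g (quasiRegularIsometry h f),
      (quasiMeasurePreserving_affine g).ae (quasiRegularIsometry_ae h f)] with x h1 h2 h3
    have hg := g.a_pos
    have hh := h.a_pos
    have e : (x - (g.a * h.b + g.b)) / (g.a * h.a) = ((x - g.b) / g.a - h.b) / h.a := by
      field_simp
      ring
    change (quasiRegularIsometry (g * h) f) x = (quasiRegularIsometry g
      (quasiRegularIsometry h f)) x
    rw [h1, h2]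
    simp only [quasiRegularFun] at h3 ⊢
    rw [h3, Aff.mul_a, Aff.mul_b, e, Real.mul_rpow hg.le hh.le]
    push_cast
    ring

/-- The Cauchy integral `[C f](z) = (2πi)⁻¹ ∫ f(t) / (t - z) dt`. -/
def cauchyIntegral (f : ℝ → ℂ) (z : ℂ) : ℂ :=
  (2 * Real.pi * Complex.I)⁻¹ * ∫ t : ℝ, f t / ((t : ℂ) - z)

theorem sub_upper_ne_zero {y : ℝ} (hy : 0 < y) (x t : ℝ) :
    (t : ℂ) - ((x : ℂ) + y * Complex.I) ≠ 0 := by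
  intro h
  have := congrArg Complex.im h
  simp at this
  exact hy.ne' this

theorem continuous_cauchyKernel {y : ℝ} (hy : 0 < y) (x : ℝ) :
    Continuous fun t : ℝ => ((t : ℂ) - ((x : ℂ) + y * Complex.I))⁻¹ :=
  Continuous.inv₀ (by fun_prop) (fun t => sub_upper_ne_zero hy x t)

theorem memLp_cauchyKernel {y : ℝ} (hy : 0 < y) (x : ℝ) :
    MemLp (fun t : ℝ => ((t : ℂ) - ((x : ℂ) + y * Complex.I))⁻¹) 2 volume := by
  rw [memLp_two_iff_integrable_sq_norm (continuous_cauchyKernel hy x).aestronglyMeasurable]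
  have h : Integrable (fun t : ℝ => (y ^ 2)⁻¹ * (1 + (t / y - x / y) ^ 2)⁻¹) :=
    (((integrable_inv_one_add_sq.comp_sub_right (x / y)).comp_div hy.ne')).const_mul _
  refine h.congr (Eventually.of_forall fun t => ?_)
  have h1 : ‖((t : ℂ) - ((x : ℂ) + y * Complex.I))‖ ^ 2 = (t - x) ^ 2 + y ^ 2 := by
    rw [← Complex.normSq_eq_norm_sq, Complex.normSq_apply]
    simp
    ring
  simp only [norm_inv, inv_pow, h1]
  rw [← mul_inv]
  congr 1
  field_simp
  ring

theorem integrable_cauchy {y : ℝ} (hy : 0 < y) (x : ℝ) {f : ℝ → ℂ} (hf : MemLp f 2 volume) :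
    Integrable (fun t : ℝ => f t / ((t : ℂ) - ((x : ℂ) + y * Complex.I))) := by
  simpa [div_eq_mul_inv, Pi.mul_def] using hf.integrable_mul (memLp_cauchyKernel hy x)

theorem aestronglyMeasurable_cauchy {y : ℝ} {f : ℝ → ℂ} (hf : MemLp f 2 volume) :
    AEStronglyMeasurable (fun x : ℝ => cauchyIntegral f ((x : ℂ) + y * Complex.I)) volume := by
  unfold cauchyIntegral
  refine AEStronglyMeasurable.const_mul ?_ _
  have h : AEStronglyMeasurable
      (fun q : ℝ × ℝ => f q.2 / ((q.2 : ℂ) - ((q.1 : ℂ) + y * Complex.I)))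
      ((volume : Measure ℝ).prod volume) := by
    have h2 : Measurable fun q : ℝ × ℝ => ((q.2 : ℂ) - ((q.1 : ℂ) + y * Complex.I))⁻¹ := by
      fun_prop
    simpa [div_eq_mul_inv, Pi.mul_def] using hf.1.comp_snd.mul h2.aestronglyMeasurable
  exact h.integral_prod_right'

/-- The Hardy space `H²`, as a subspace of `L²(ℝ)`: those `f` that are the boundary values of
their own Cauchy integral, i.e. `[C f](· + iy) → f` in `L²(ℝ)` as `y → 0⁺`. -/
def hardySpace : Submodule ℂ L2R where
  carrier := {f | Tendsto (fun y : ℝ => eLpNorm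
    (fun x : ℝ => cauchyIntegral f ((x : ℂ) + y * Complex.I) - f x) 2 volume) (𝓝[>] 0) (𝓝 0)}
  zero_mem' := by
    have h : ∀ z, cauchyIntegral (0 : L2R) z = 0 := by
      intro z
      have : (fun t : ℝ => (0 : L2R) t / ((t : ℂ) - z)) =ᵐ[volume] 0 := by
        filter_upwards [Lp.coeFn_zero ℂ 2 (volume : Measure ℝ)] with t ht
        rw [ht]; simp
      unfold cauchyIntegral
      rw [integral_congr_ae this]
      simp
    refine tendsto_const_nhds.congr fun y => ?_
    refine (eLpNorm_eq_zero_of_ae_zero ?_).symm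
    filter_upwards [Lp.coeFn_zero ℂ 2 (volume : Measure ℝ)] with t ht
    rw [ht, h]; simp
  add_mem' := by
    intro f g hf hg
    have hfg := Tendsto.add hf hg
    rw [add_zero] at hfg
    refine tendsto_of_tendsto_of_tendsto_of_le_of_le' tendsto_const_nhds hfg
      (Eventually.of_forall fun _ => zero_le) ?_
    filter_upwards [self_mem_nhdsWithin] with y hy
    have hC : ∀ x : ℝ, cauchyIntegral (f + g : L2R) ((x : ℂ) + y * Complex.I) =
        cauchyIntegral f ((x : ℂ) + y * Complex.I) +
          cauchyIntegral g ((x : ℂ) + y * Complex.I) := by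
      intro x
      unfold cauchyIntegral
      rw [← mul_add, ← integral_add (integrable_cauchy hy x (Lp.memLp f))
        (integrable_cauchy hy x (Lp.memLp g))]
      congr 1
      apply integral_congr_ae
      filter_upwards [Lp.coeFn_add f g] with t ht
      rw [ht, Pi.add_apply, add_div]
    refine le_trans (le_of_eq (eLpNorm_congr_ae ?_)) (eLpNorm_add_le
      ((aestronglyMeasurable_cauchy (Lp.memLp f)).sub (Lp.aestronglyMeasurable f))
      ((aestronglyMeasurable_cauchy (Lp.memLp g)).sub (Lp.aestronglyMeasurable g))
      (by norm_num))
    filter_upwards [Lp.coeFn_add f g] with x hx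
    simp only [hC, hx, Pi.add_apply]
    ring
  smul_mem' := by
    intro c f hf
    have hcf := ENNReal.Tendsto.const_mul (a := ‖c‖ₑ) hf (Or.inr enorm_ne_top)
    rw [mul_zero] at hcf
    refine hcf.congr fun y => ?_
    rw [← eLpNorm_const_smul]
    refine eLpNorm_congr_ae ?_
    have hC : ∀ z : ℂ, cauchyIntegral (c • f : L2R) z = c * cauchyIntegral f z := by
      intro z
      unfold cauchyIntegral
      rw [mul_left_comm c, ← integral_const_mul c]
      congr 1
      apply integral_congr_ae
      filter_upwards [Lp.coeFn_smul c f] with t ht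
      rw [ht, Pi.smul_apply, smul_eq_mul, mul_div_assoc]
    filter_upwards [Lp.coeFn_smul c f] with x hx
    simp only [hC, hx, Pi.smul_apply, smul_eq_mul]
    ring

/-- `T = k₁ I ⊕ k₂ I` with respect to the orthogonal decomposition `L²(ℝ) = H² ⊕ (H²)^⊥`
(that the two subspaces do decompose the whole space is part of the assertion). -/
def IsHardyScalar (T : L2R →L[ℂ] L2R) (k₁ k₂ : ℂ) : Prop :=
  IsCompl hardySpace hardySpaceᗮ ∧
    (∀ f ∈ hardySpace, T f = k₁ • f) ∧ ∀ f ∈ hardySpaceᗮ, T f = k₂ • f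

/-- `𝓕 T 𝓕⁻¹` is the operator of multiplication by the function `m`. -/
def IsFourierMultiplier (T : L2R →L[ℂ] L2R) (m : ℝ → ℂ) : Prop :=
  ∀ h : L2R, (𝓕 (T (𝓕⁻ h)) : L2R) =ᵐ[volume] fun x => m x * h x

end

/-! The Fourier transform turns translations into modulations and dilation by `a` into dilation by
`a⁻¹` (`fourier_quasiRegular`). Hence `𝓕 T 𝓕⁻¹` commutes with all modulations, so it is
multiplication by a function `m` (`exists_multiplier`). Commuting with dilations gives `m (a * x) =
m x` for almost every `x`, for each `a > 0`, and so `m` is constant on each half-line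
(`exists_ae_eq_const_on_cone`).

On the Hardy side, the Cauchy integral at height `y` is the Fourier multiplier `1_{λ > 0} e^{-2πyλ}`
(`cauchyIntegral_ae`). Letting `y → 0⁺` identifies `H²` with the functions whose spectrum lies in
the positive half-line (`mem_hardySpace_iff`), and its orthogonal complement with those whose
spectrum lies in the negative one. The two descriptions of `T` then agree; this last equivalence
needs no commutation. -/

/-! ### The `L²` Fourier transform and the Fourier integral -/

theorem integral_fourier_schwartz_mul (g : SchwartzMap ℝ ℂ) {F : ℝ → ℂ} (hF : Integrable F) :
    ∫ x, (𝓕 g) x * F x = ∫ x, g x * 𝓕 F x := by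
  simpa using! VectorFourier.integral_fourierIntegral_smul_eq_flip (L := innerₗ ℝ) (μ := volume)
    (ν := volume) Real.continuous_fourierChar continuous_inner g.integrable hF

theorem integral_fourierInv_schwartz_mul (g : SchwartzMap ℝ ℂ) {F : ℝ → ℂ} (hF : Integrable F) :
    ∫ x, (𝓕⁻ g) x * F x = ∫ x, g x * 𝓕⁻ F x := by
  rw [SchwartzMap.fourierInv_coe]
  -- The inverse transform is the Fourier integral for the symmetric form `-⟨·, ·⟩`.
  have h := VectorFourier.integral_fourierIntegral_smul_eq_flip (L := -innerₗ ℝ)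
    (μ := volume) (ν := volume) Real.continuous_fourierChar
    (continuous_inner (𝕜 := ℝ) (E := ℝ)).neg g.integrable hF
  have hL : (-innerₗ ℝ).flip = -innerₗ ℝ := by ext; simp
  rw [hL] at h
  exact h

theorem ae_eq_of_integral_schwartz {F G : ℝ → ℂ} (hF : LocallyIntegrable F)
    (hG : LocallyIntegrable G)
    (h : ∀ g : SchwartzMap ℝ ℂ, ∫ x, g x * F x = ∫ x, g x * G x) : F =ᵐ[volume] G := by
  refine ae_eq_of_integral_contDiff_smul_eq hF hG fun g hg hc => ?_
  have hc' : HasCompactSupport (fun x => (g x : ℂ)) := hc.comp_left (g := Complex.ofReal) rfl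
  have hg' : ContDiff ℝ (⊤ : ℕ∞) (fun x => (g x : ℂ)) := Complex.ofRealCLM.contDiff.comp hg
  simpa using h (hc'.toSchwartzMap hg')

theorem ae_eq_zero_of_fourier_eq_zero {F : ℝ → ℂ} (hF : Integrable F) (h : ∀ w, 𝓕 F w = 0) :
    F =ᵐ[volume] 0 := by
  refine ae_eq_of_integral_schwartz hF.locallyIntegrable (integrable_zero ℝ ℂ _).locallyIntegrable
    fun g => ?_
  have := integral_fourier_schwartz_mul (𝓕⁻ g) hF
  rw [FourierTransform.fourier_fourierInv_eq] at this
  simp [this, h]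

/-- Both sides define the same tempered distribution: in each case the transform can be moved onto
the Schwartz test function. -/
theorem Lp_fourier_ae {f : ℝ → ℂ} (hf : MemLp f 2 volume) (hi : Integrable f) :
    (𝓕 (hf.toLp f) : L2R) =ᵐ[volume] 𝓕 f := by
  have hc : Continuous (𝓕 f) := VectorFourier.fourierIntegral_continuous
    Real.continuous_fourierChar continuous_inner hi
  refine ae_eq_of_integral_schwartz ((Lp.memLp _).locallyIntegrable (by norm_num))
    hc.locallyIntegrable fun g => ?_
  have h := congrArg (fun u => u g) (Lp.fourier_toTemperedDistribution_eq (hf.toLp f))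
  simp only [TemperedDistribution.fourier_apply, Lp.toTemperedDistribution_apply, smul_eq_mul] at h
  rw [← h, ← integral_fourier_schwartz_mul g hi]
  exact integral_congr_ae (hf.coeFn_toLp.mono fun x hx => by simp only [hx])

theorem Lp_fourierInv_ae {f : ℝ → ℂ} (hf : MemLp f 2 volume) (hi : Integrable f) :
    (𝓕⁻ (hf.toLp f) : L2R) =ᵐ[volume] 𝓕⁻ f := by
  have hc : Continuous (𝓕⁻ f) := VectorFourier.fourierIntegral_continuous
    Real.continuous_fourierChar (by fun_prop) hi
  refine ae_eq_of_integral_schwartz ((Lp.memLp _).locallyIntegrable (by norm_num))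
    hc.locallyIntegrable fun g => ?_
  have h := congrArg (fun u => u g) (Lp.fourierInv_toTemperedDistribution_eq (hf.toLp f))
  simp only [TemperedDistribution.fourierInv_apply, Lp.toTemperedDistribution_apply, smul_eq_mul] at h
  rw [← h, ← integral_fourierInv_schwartz_mul g hi]
  exact integral_congr_ae (hf.coeFn_toLp.mono fun x hx => by simp only [hx])

/-! ### Multiplication operators and the representation on the Fourier side -/

/-- Multiplication by an essentially bounded function, as an operator on `L²(ℝ)`. -/
noncomputable def mulL2 {m : ℝ → ℂ} (hm : MemLp m ∞ volume) : L2R →L[ℂ] L2R :=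
  (ContinuousLinearMap.mul ℂ ℂ).holderL volume ∞ 2 2 (hm.toLp m)

theorem mulL2_ae {m : ℝ → ℂ} (hm : MemLp m ∞ volume) (f : L2R) :
    mulL2 hm f =ᵐ[volume] fun x => m x * f x := by
  filter_upwards [(ContinuousLinearMap.mul ℂ ℂ).coeFn_holder (r := 2) (hm.toLp m) f, hm.coeFn_toLp]
    with x h1 h2
  rw [← h2]
  exact h1

theorem quasiRegular_ae (g : Aff) (f : L2R) :
    quasiRegular g f =ᵐ[volume] quasiRegularFun g f :=
  quasiRegularIsometry_ae g f

theorem memLp_top_fourierChar (b : ℝ) :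
    MemLp (fun x : ℝ => ((Real.fourierChar (-(b * x)) : Circle) : ℂ)) ∞ volume :=
  memLp_top_of_bound (by fun_prop) 1 (Eventually.of_forall fun x => (Circle.norm_coe _).le)

theorem fourier_quasiRegularFun (g : Aff) (f : ℝ → ℂ) (w : ℝ) :
    𝓕 (quasiRegularFun g f) w = ((Real.fourierChar (-(g.b * w)) : Circle) : ℂ) *
      quasiRegularFun ⟨g.a⁻¹, 0, inv_pos.2 g.a_pos⟩ (𝓕 f) w := by
  have ha := g.a_pos
  rw [Real.fourier_real_eq]
  have h1 := integral_sub_right_eq_self (μ := (volume : Measure ℝ))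
    (fun x : ℝ => Real.fourierChar (-((x + g.b) * w)) •
      (((g.a ^ (-(1 / 2) : ℝ) : ℝ) : ℂ) * f (x / g.a))) g.b
  have h2 := Measure.integral_comp_div
    (fun x : ℝ => Real.fourierChar (-((g.a * x + g.b) * w)) •
      (((g.a ^ (-(1 / 2) : ℝ) : ℝ) : ℂ) * f x)) g.a
  simp only [sub_add_cancel] at h1
  simp only [mul_div_cancel₀ _ ha.ne'] at h2
  simp only [quasiRegularFun]
  rw [h1, h2, Real.fourier_real_eq, ← integral_const_mul, ← integral_const_mul, ← integral_smul]
  congr 1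
  funext x
  have h3 : -((g.a * x + g.b) * w) = -(g.b * w) + -(x * ((w - 0) / g.a⁻¹)) := by
    field_simp; ring
  -- The Jacobian `a` turns the normalization `a^(-1/2)` into `a^(1/2)`, the one for dilation by
  -- `a⁻¹`.
  have h4 : |g.a| * g.a ^ (-(1 / 2) : ℝ) = (g.a⁻¹) ^ (-(1 / 2) : ℝ) := by
    rw [abs_of_pos ha, Real.inv_rpow ha.le, Real.rpow_neg ha.le, inv_inv]
    nth_rewrite 1 [← Real.sqrt_eq_rpow]
    rw [← Real.sqrt_eq_rpow]
    exact Real.div_sqrt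
  rw [h3, AddChar.map_add_eq_mul, ← h4]
  simp only [Circle.smul_def, Circle.coe_mul, smul_eq_mul, Complex.real_smul]
  push_cast
  ring

/-- Both sides are continuous in `f`, so it suffices to treat Schwartz functions, where the Fourier
integral can be computed by substitution. -/
theorem fourier_quasiRegular (g : Aff) (f : L2R) :
    𝓕 (quasiRegular g f) = mulL2 (memLp_top_fourierChar g.b)
      (quasiRegular ⟨g.a⁻¹, 0, inv_pos.2 g.a_pos⟩ (𝓕 f)) := by
  let D : Aff := ⟨g.a⁻¹, 0, inv_pos.2 g.a_pos⟩
  have hF : Continuous fun f : L2R => (𝓕 f : L2R) := (Lp.fourierTransformₗᵢ ℝ ℂ).continuous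
  refine DenseRange.induction_on
    (SchwartzMap.denseRange_toLpCLM (E := ℝ) (F := ℂ) (p := 2) (μ := volume)
      ENNReal.ofNat_ne_top) f
    (isClosed_eq (hF.comp (quasiRegular g).continuous)
      ((mulL2 _).continuous.comp ((quasiRegular D).continuous.comp hF))) fun s => ?_
  rw [SchwartzMap.toLpCLM_apply, SchwartzMap.toLp_fourier_eq]
  have hs : MemLp s 2 volume := s.memLp 2
  have hi : Integrable (quasiRegularFun g s) :=
    (((s.integrable (μ := volume)).comp_div g.a_pos.ne').comp_sub_right g.b).const_mul _
  have e : quasiRegular g (s.toLp 2) = (memLp_quasiRegularFun g hs).toLp _ := by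
    apply Lp.ext
    filter_upwards [quasiRegular_ae g (s.toLp 2), (memLp_quasiRegularFun g hs).coeFn_toLp,
      (quasiMeasurePreserving_affine g).ae (s.coeFn_toLp 2 volume)] with x h1 h2 h3
    rw [h1, h2, quasiRegularFun, quasiRegularFun, h3]
  rw [e]
  apply Lp.ext
  filter_upwards [Lp_fourier_ae (memLp_quasiRegularFun g hs) hi,
    mulL2_ae (memLp_top_fourierChar g.b) (quasiRegular D ((𝓕 s).toLp 2)),
    quasiRegular_ae D ((𝓕 s).toLp 2),
    (quasiMeasurePreserving_affine D).ae ((𝓕 s).coeFn_toLp 2 volume)] with x h1 h2 h3 h4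
  rw [h1, h2, h3, fourier_quasiRegularFun, quasiRegularFun, quasiRegularFun, h4]
  rfl

theorem fourier_quasiRegular_translation (b : ℝ) (f : L2R) :
    𝓕 (quasiRegular ⟨1, b, one_pos⟩ f) = mulL2 (memLp_top_fourierChar b) (𝓕 f) := by
  rw [fourier_quasiRegular]
  have h : (⟨(1 : ℝ)⁻¹, 0, inv_pos.2 one_pos⟩ : Aff) = 1 := by ext <;> simp
  rw [h, map_one]
  rfl

theorem fourier_quasiRegular_dilation {a : ℝ} (ha : 0 < a) (f : L2R) :
    𝓕 (quasiRegular ⟨a, 0, ha⟩ f) = quasiRegular ⟨a⁻¹, 0, inv_pos.2 ha⟩ (𝓕 f) := by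
  rw [fourier_quasiRegular]
  apply Lp.ext
  filter_upwards [mulL2_ae (memLp_top_fourierChar 0)
    (quasiRegular ⟨a⁻¹, 0, inv_pos.2 ha⟩ (𝓕 f))] with x hx
  rw [hx]
  simp

/-! ### Operators commuting with modulations and dilations -/

/-- Such a `φ` stands in for the constant `1`, which is not in `L²`, and can be divided out. -/
theorem exists_L2_ae_ne_zero : ∃ φ : L2R, ∀ᵐ x, φ x ≠ 0 := by
  have h : MemLp (fun x : ℝ => (Real.exp (-x ^ 2 / 2) : ℂ)) 2 volume := by
    rw [memLp_two_iff_integrable_sq_norm (by fun_prop)]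
    have := integrable_exp_neg_mul_sq (b := 1) one_pos
    refine this.congr (Eventually.of_forall fun x => ?_)
    simp only [Complex.norm_real, Real.norm_of_nonneg (Real.exp_pos _).le]
    rw [← Real.exp_nat_mul]
    congr 1
    push_cast
    ring
  refine ⟨h.toLp _, h.coeFn_toLp.mono fun x hx => ?_⟩
  rw [hx]
  exact Complex.ofReal_ne_zero.2 (Real.exp_pos _).ne'

/-- An operator commuting with all modulations is a multiplication operator. -/
theorem exists_multiplier {M : L2R →L[ℂ] L2R}
    (hM : ∀ b f, M (mulL2 (memLp_top_fourierChar b) f) = mulL2 (memLp_top_fourierChar b) (M f)) :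
    ∃ m : ℝ → ℂ, StronglyMeasurable m ∧ ∀ f, M f =ᵐ[volume] fun x => m x * f x := by
  obtain ⟨φ, hφ⟩ := exists_L2_ae_ne_zero
  -- With `G = M* φ`, pairing `φ` with modulations of `M f` shows that the integrable functions
  -- `conj G * f` and `conj φ * M f` have the same Fourier transform. So they agree, and `m = conj G
  -- / conj φ`; the inner products with `1` below are these conjugates.
  set G := ContinuousLinearMap.adjoint M φ with hG
  let m₀ : ℝ → ℂ := fun x => inner ℂ (G x) 1 / inner ℂ (φ x) 1
  have hm₀ : AEStronglyMeasurable m₀ volume := by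
    have h1 := (Lp.aestronglyMeasurable G).inner (𝕜 := ℂ)
      (aestronglyMeasurable_const (b := (1 : ℂ)) (μ := volume))
    have h2 := (Lp.aestronglyMeasurable φ).inner (𝕜 := ℂ)
      (aestronglyMeasurable_const (b := (1 : ℂ)) (μ := volume))
    exact (h1.aemeasurable.div h2.aemeasurable).aestronglyMeasurable
  refine ⟨hm₀.mk, hm₀.stronglyMeasurable_mk, fun f => ?_⟩
  have hi : ∀ u v : L2R, Integrable (fun x => inner ℂ (u x) (v x)) := fun u v =>
    L2.integrable_inner u v
  have key : ∀ (u v : L2R) (b : ℝ), inner ℂ u (mulL2 (memLp_top_fourierChar b) v) =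
      𝓕 (fun x => inner ℂ (u x) (v x)) b := by
    intro u v b
    rw [L2.inner_def, Real.fourier_real_eq]
    refine integral_congr_ae ?_
    filter_upwards [mulL2_ae (memLp_top_fourierChar b) v] with x hx
    rw [hx, Circle.smul_def, smul_eq_mul, mul_comm b x]
    simp only [RCLike.inner_apply]
    ring
  have hz := ae_eq_zero_of_fourier_eq_zero ((hi G f).sub (hi φ (M f))) fun b => by
    have h1 : inner ℂ G (mulL2 (memLp_top_fourierChar b) f) =
        inner ℂ φ (mulL2 (memLp_top_fourierChar b) (M f)) := by
      rw [hG, ContinuousLinearMap.adjoint_inner_left, hM]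
    rw [key, key] at h1
    have hc : ∀ u v : L2R, Integrable fun x =>
        Real.fourierChar (-(x * b)) • (inner ℂ (u x) (v x) : ℂ) := fun u v => by
      simpa [mul_comm] using (Real.fourierIntegral_convergent_iff b).2 (hi u v)
    rw [Real.fourier_real_eq, Real.fourier_real_eq] at h1
    rw [Real.fourier_real_eq]
    simp only [Pi.sub_apply, smul_sub]
    rw [integral_sub (hc G f) (hc φ (M f)), h1, sub_self]
  filter_upwards [hz, hφ, hm₀.ae_eq_mk] with x h1 h2 h3
  rw [← h3]
  simp only [m₀, Pi.sub_apply, Pi.zero_apply, RCLike.inner_apply] at h1 ⊢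
  have : (starRingEnd ℂ) (φ x) ≠ 0 := by simpa using h2
  field_simp
  linear_combination -h1

/-- The exceptional null set depends on `a`, so Fubini is used to exchange the quantifiers: some
fixed `x ∈ s` has `m (a * x) = m x` for almost every `a > 0`. As the ratios within `s` are positive,
the points `a * x` cover `s`, and `m x` is the constant. -/
theorem exists_ae_eq_const_on_cone {m : ℝ → ℂ} (hm : StronglyMeasurable m)
    (h : ∀ a : ℝ, 0 < a → ∀ᵐ x, m (a * x) = m x) {s : Set ℝ} (hs : volume s ≠ 0)
    (hc : ∀ x ∈ s, x ≠ 0 ∧ ∀ y ∈ s, 0 < y / x) : ∃ k, ∀ᵐ x, x ∈ s → m x = k := by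
  have hmm := hm.measurable
  have h1 : ∀ᵐ a : ℝ, ∀ᵐ x : ℝ, 0 < a → m (a * x) = m x := by
    refine Eventually.of_forall fun a => ?_
    by_cases ha : 0 < a
    · exact (h a ha).mono fun x hx _ => hx
    · exact Eventually.of_forall fun x hx => absurd hx ha
  have hmeas : MeasurableSet {q : ℝ × ℝ | 0 < q.1 → m (q.1 * q.2) = m q.2} := by
    have e : {q : ℝ × ℝ | 0 < q.1 → m (q.1 * q.2) = m q.2} =
        {q : ℝ × ℝ | 0 < q.1}ᶜ ∪ {q : ℝ × ℝ | m (q.1 * q.2) = m q.2} := by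
      ext q; simp [imp_iff_not_or]
    rw [e]
    exact (measurableSet_lt measurable_const measurable_fst).compl.union
      (measurableSet_eq_fun (hmm.comp (measurable_fst.mul measurable_snd))
        (hmm.comp measurable_snd))
  have h2 := (Measure.ae_ae_comm hmeas).1 h1
  obtain ⟨x, hxs, hx⟩ : ∃ x ∈ s, ∀ᵐ a : ℝ, 0 < a → m (a * x) = m x := by
    by_contra hcon
    refine hs (measure_mono_null (fun x hx => ?_) h2)
    exact fun h3 => hcon ⟨x, hx, h3⟩
  obtain ⟨hx0, hy⟩ := hc x hxs
  have hq : Measure.QuasiMeasurePreserving (fun y : ℝ => y * x⁻¹) volume volume :=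
    ⟨by fun_prop, by
      rw [Real.map_volume_mul_right (inv_ne_zero hx0)]; exact Measure.smul_absolutelyContinuous⟩
  refine ⟨m x, (hq.ae hx).mono fun y h3 hys => ?_⟩
  have := h3 (by simpa [div_eq_mul_inv] using hy y hys)
  rwa [inv_mul_cancel_right₀ hx0] at this

theorem exists_const_multiplier {M : L2R →L[ℂ] L2R}
    (hM : ∀ b f, M (mulL2 (memLp_top_fourierChar b) f) = mulL2 (memLp_top_fourierChar b) (M f))
    (hD : ∀ (a : ℝ) (ha : 0 < a) (f : L2R),
      M (quasiRegular ⟨a, 0, ha⟩ f) = quasiRegular ⟨a, 0, ha⟩ (M f)) :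
    ∃ k₁ k₂ : ℂ, ∀ f, M f =ᵐ[volume] fun x =>
      (k₁ * (Set.Ioi (0 : ℝ)).indicator 1 x + k₂ * (Set.Iio (0 : ℝ)).indicator 1 x) * f x := by
  obtain ⟨m, hm, hf⟩ := exists_multiplier hM
  have h : ∀ a : ℝ, 0 < a → ∀ᵐ x, m (a * x) = m x := by
    intro a ha
    obtain ⟨φ, hφ⟩ := exists_L2_ae_ne_zero
    -- Dilation by `a⁻¹` evaluates at `a * x`; testing it on `φ` allows the nonzero factor to be
    -- cancelled.
    let D : Aff := ⟨a⁻¹, 0, inv_pos.2 ha⟩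
    have hq := quasiMeasurePreserving_affine D
    have e := hD a⁻¹ D.a_pos φ
    filter_upwards [hf (quasiRegular D φ), quasiRegular_ae D φ, quasiRegular_ae D (M φ),
      hq.ae (hf φ), hq.ae hφ] with x h1 h2 h3 h4 h5
    have hx : (x - D.b) / D.a = a * x := by simp [D, mul_comm]
    rw [e, h3, h2] at h1
    simp only [quasiRegularFun] at h1
    rw [h4] at h1
    rw [hx] at h1 h5
    have hc : ((D.a ^ (-(1 / 2) : ℝ) : ℝ) : ℂ) ≠ 0 := by
      exact_mod_cast (Real.rpow_pos_of_pos D.a_pos _).ne'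
    refine mul_right_cancel₀ (mul_ne_zero hc h5) ?_
    linear_combination h1
  obtain ⟨k₁, h₁⟩ := exists_ae_eq_const_on_cone hm h (s := Set.Ioi 0) (by simp)
    fun x hx => ⟨ne_of_gt hx, fun y hy => div_pos hy hx⟩
  obtain ⟨k₂, h₂⟩ := exists_ae_eq_const_on_cone hm h (s := Set.Iio 0) (by simp)
    fun x hx => ⟨ne_of_lt hx, fun y hy => div_pos_of_neg_of_neg hy hx⟩
  refine ⟨k₁, k₂, fun f => ?_⟩
  filter_upwards [hf f, h₁, h₂, Measure.ae_ne volume (0 : ℝ)] with x h3 h4 h5 h6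
  rw [h3]
  rcases lt_or_gt_of_ne h6 with hx | hx
  · rw [h5 hx]; simp [hx, hx.le]
  · rw [h4 hx]; simp [hx, hx.le]

/-! ### The Cauchy integral as a Fourier multiplier -/

/-- The one-sided exponential `1_{λ > 0} e^{cλ}`. -/
noncomputable def oneSidedExp (c : ℂ) : ℝ → ℂ :=
  (Set.Ioi (0 : ℝ)).indicator fun l => Complex.exp (c * l)

theorem measurable_oneSidedExp (c : ℂ) : Measurable (oneSidedExp c) :=
  Measurable.indicator (by fun_prop) measurableSet_Ioi

theorem norm_oneSidedExp_le {c : ℂ} (hc : c.re ≤ 0) (l : ℝ) : ‖oneSidedExp c l‖ ≤ 1 := by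
  unfold oneSidedExp
  by_cases hl : l ∈ Set.Ioi (0 : ℝ)
  · rw [Set.indicator_of_mem hl, Complex.norm_exp, Real.exp_le_one_iff]
    simpa using mul_nonpos_of_nonpos_of_nonneg hc (le_of_lt hl)
  · rw [Set.indicator_of_notMem hl]; simp

theorem memLp_top_oneSidedExp {c : ℂ} (hc : c.re ≤ 0) : MemLp (oneSidedExp c) ∞ volume :=
  memLp_top_of_bound (measurable_oneSidedExp c).aestronglyMeasurable 1
    (Eventually.of_forall (norm_oneSidedExp_le hc))

theorem integrable_oneSidedExp {c : ℂ} (hc : c.re < 0) : Integrable (oneSidedExp c) :=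
  (integrableOn_exp_mul_complex_Ioi hc 0).integrable_indicator measurableSet_Ioi

theorem memLp_two_oneSidedExp {c : ℂ} (hc : c.re < 0) : MemLp (oneSidedExp c) 2 volume := by
  rw [memLp_two_iff_integrable_sq_norm (measurable_oneSidedExp c).aestronglyMeasurable]
  refine (integrable_oneSidedExp hc).norm.mono'
    ((measurable_oneSidedExp c).norm.pow_const 2).aestronglyMeasurable
    (Eventually.of_forall fun l => ?_)
  rw [Real.norm_of_nonneg (by positivity), sq]
  exact mul_le_of_le_one_left (norm_nonneg _) (norm_oneSidedExp_le hc.le l)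

theorem fourierInv_oneSidedExp {c : ℂ} (hc : c.re < 0) (t : ℝ) :
    𝓕⁻ (oneSidedExp c) t = -(c + 2 * Real.pi * Complex.I * t)⁻¹ := by
  have h0 : (c + 2 * Real.pi * Complex.I * t).re < 0 := by simpa using hc
  have h := integral_exp_mul_complex_Ioi h0 0
  rw [Complex.ofReal_zero, mul_zero, Complex.exp_zero, ← integral_indicator measurableSet_Ioi] at h
  rw [Real.fourierInv_eq', ← one_div, ← neg_div, ← h]
  congr 1
  funext l
  unfold oneSidedExp
  by_cases hl : l ∈ Set.Ioi (0 : ℝ)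
  · rw [Set.indicator_of_mem hl, Set.indicator_of_mem hl, smul_eq_mul, ← Complex.exp_add]
    congr 1
    simp
    ring
  · rw [Set.indicator_of_notMem hl, Set.indicator_of_notMem hl, smul_zero]

/-- The absolute value keeps the multiplier bounded for every real `y`, so that `poissonMul` needs
no sign hypothesis. -/
theorem decay_re_nonpos (y : ℝ) : (-(2 * Real.pi * |y| : ℝ) : ℂ).re ≤ 0 := by
  have : 0 ≤ 2 * Real.pi * |y| := by positivity
  rw [← Complex.ofReal_neg, Complex.ofReal_re]
  linarith

/-- The multiplier `1_{λ > 0} e^{-2π|y|λ}`. -/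
noncomputable def poissonMul (y : ℝ) : L2R →L[ℂ] L2R :=
  mulL2 (memLp_top_oneSidedExp (decay_re_nonpos y))

/-- The Cauchy integral along the line at height `y` is the Fourier multiplier
`1_{λ > 0} e^{-2πyλ}`. -/
theorem cauchyIntegral_ae {y : ℝ} (hy : 0 < y) (f : L2R) :
    (fun x : ℝ => cauchyIntegral f ((x : ℂ) + y * Complex.I)) =ᵐ[volume]
      (𝓕⁻ (poissonMul y (𝓕 f)) : L2R) := by
  have hpi := Real.pi_pos
  have hd : (-(2 * Real.pi * |y| : ℝ) : ℂ).re < 0 := by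
    have : 0 < 2 * Real.pi * |y| := by positivity
    rw [← Complex.ofReal_neg, Complex.ofReal_re]
    linarith
  set u : ℝ → ℂ := fun l => oneSidedExp (-(2 * Real.pi * |y| : ℝ) : ℂ) l * (𝓕 f : L2R) l with hu
  have hi : Integrable u := (memLp_two_oneSidedExp hd).integrable_mul (Lp.memLp _)
  have hm := mulL2_ae (memLp_top_oneSidedExp (decay_re_nonpos y)) (𝓕 f)
  have hu2 : MemLp u 2 volume := (memLp_congr_ae hm).1 (Lp.memLp _)
  have e : poissonMul y (𝓕 f) = hu2.toLp u := Lp.ext (hm.trans hu2.coeFn_toLp.symm)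
  rw [e]
  filter_upwards [Lp_fourierInv_ae hu2 hi] with x hx
  rw [hx]
  -- For this `c`, the conjugate of `𝓕⁻ (oneSidedExp c)` is the Cauchy kernel at `x + iy` including
  -- the factor `(2πi)⁻¹`. Plancherel then turns the Cauchy integral into the inverse Fourier
  -- integral of `u` at `x`.
  let c : ℂ := -(2 * Real.pi * y : ℝ) - 2 * Real.pi * x * Complex.I
  have hc : c.re < 0 := by
    have : 0 < 2 * Real.pi * y := by positivity
    simp [c]
    linarith
  let E : L2R := (memLp_two_oneSidedExp hc).toLp _
  have h1 : inner ℂ (𝓕⁻ E : L2R) f = inner ℂ E (𝓕 f : L2R) := by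
    rw [← Lp.inner_fourier_eq, FourierTransform.fourier_fourierInv_eq]
  rw [L2.inner_def, L2.inner_def] at h1
  have hl : ∫ t, inner ℂ ((𝓕⁻ E : L2R) t) (f t) =
      cauchyIntegral f ((x : ℂ) + y * Complex.I) := by
    rw [cauchyIntegral, ← integral_const_mul]
    refine integral_congr_ae ?_
    filter_upwards [Lp_fourierInv_ae (memLp_two_oneSidedExp hc) (integrable_oneSidedExp hc)]
      with t ht
    rw [ht, fourierInv_oneSidedExp hc, RCLike.inner_apply]
    have e1 : (starRingEnd ℂ) (-(c + 2 * Real.pi * Complex.I * t)⁻¹) =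
        (2 * Real.pi * Complex.I)⁻¹ * ((t : ℂ) - ((x : ℂ) + y * Complex.I))⁻¹ := by
      rw [map_neg, map_inv₀, ← mul_inv, ← inv_neg]
      congr 1
      simp only [c, map_add, map_sub, map_neg, map_mul, Complex.conj_ofReal, Complex.conj_I]
      push_cast
      simp only [map_ofNat]
      linear_combination (2 * Real.pi * y : ℂ) * Complex.I_sq
    rw [e1]
    ring
  have hr : ∫ t, inner ℂ (E t) ((𝓕 f : L2R) t) = 𝓕⁻ u x := by
    rw [Real.fourierInv_eq']
    refine integral_congr_ae ?_
    filter_upwards [(memLp_two_oneSidedExp hc).coeFn_toLp] with l h2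
    rw [h2, RCLike.inner_apply]
    simp only [hu, oneSidedExp, smul_eq_mul]
    by_cases hl : l ∈ Set.Ioi (0 : ℝ)
    · rw [Set.indicator_of_mem hl, Set.indicator_of_mem hl, ← Complex.exp_conj, ← mul_assoc,
        ← Complex.exp_add, mul_comm]
      congr 2
      simp only [c, abs_of_pos hy, map_mul, map_sub, map_neg, Complex.conj_ofReal, Complex.conj_I,
        map_ofNat, RCLike.inner_apply, conj_trivial]
      push_cast
      ring
    · rw [Set.indicator_of_notMem hl, Set.indicator_of_notMem hl]
      simp
  rw [← hl, h1, hr]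

/-! ### Spectral description of the Hardy space and its complement -/

theorem mem_hardySpace_iff_tendsto (f : L2R) :
    f ∈ hardySpace ↔ Tendsto (fun y => poissonMul y (𝓕 f)) (𝓝[>] 0) (𝓝 (𝓕 f)) := by
  change Tendsto (fun y : ℝ => eLpNorm
    (fun x : ℝ => cauchyIntegral f ((x : ℂ) + y * Complex.I) - f x) 2 volume) (𝓝[>] 0) (𝓝 0) ↔ _
  rw [tendsto_iff_edist_tendsto_0]
  refine tendsto_congr' ?_
  filter_upwards [self_mem_nhdsWithin] with y hy
  have h1 : edist (poissonMul y (𝓕 f)) (𝓕 f) = edist (𝓕⁻ (poissonMul y (𝓕 f)) : L2R) f := by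
    have h2 := (Lp.fourierTransformₗᵢ ℝ ℂ).edist_map (𝓕⁻ (poissonMul y (𝓕 f))) f
    rw [← h2]
    congr 1
    exact ((Lp.fourierTransformₗᵢ ℝ ℂ).apply_symm_apply _).symm
  rw [h1, Lp.edist_def]
  exact eLpNorm_congr_ae ((cauchyIntegral_ae hy f).mono fun x hx => by simp only [hx, Pi.sub_apply])

theorem tendsto_poissonMul {h : L2R} (hh : ∀ᵐ l, l < 0 → h l = 0) :
    Tendsto (fun y => poissonMul y h) (𝓝[>] 0) (𝓝 h) := by
  rw [tendsto_iff_norm_sub_tendsto_zero]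
  -- The squared norm tends to zero by dominated convergence: the multiplier minus `1` has modulus
  -- at most `2`, which gives the bound `4 * ‖h‖ ^ 2`.
  have key : Tendsto (fun y => ∫ l, inner ℂ ((poissonMul y h - h) l) ((poissonMul y h - h) l))
      (𝓝[>] 0) (𝓝 (∫ _ : ℝ, (0 : ℂ))) := by
    have hp : ∀ y : ℝ, ∀ᵐ l, (poissonMul y h - h) l =
        (oneSidedExp (-(2 * Real.pi * |y| : ℝ) : ℂ) l - 1) * h l := fun y => by
      filter_upwards [Lp.coeFn_sub (poissonMul y h) h,
        mulL2_ae (memLp_top_oneSidedExp (decay_re_nonpos y)) h] with l h1 h2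
      rw [h1, Pi.sub_apply, poissonMul, h2]
      ring
    have hi : Integrable (fun l => ‖h l‖ ^ 2) :=
      (memLp_two_iff_integrable_sq_norm (Lp.aestronglyMeasurable h)).1 (Lp.memLp h)
    have hlim : ∀ᵐ l : ℝ, Tendsto (fun y : ℝ =>
        (((‖oneSidedExp (-(2 * Real.pi * |y| : ℝ) : ℂ) l - 1‖ * ‖h l‖) ^ 2 : ℝ) : ℂ))
        (𝓝[>] 0) (𝓝 0) := by
      filter_upwards [hh, Measure.ae_ne volume (0 : ℝ)] with l h1 h2
      rcases lt_or_gt_of_ne h2 with hl | hl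
      · rw [h1 hl]; simp
      · have hc : Continuous fun y : ℝ =>
            (((‖Complex.exp ((-(2 * Real.pi * |y| : ℝ) : ℂ) * l) - 1‖ * ‖h l‖) ^ 2 : ℝ) : ℂ) := by
          fun_prop
        have := (hc.tendsto 0).mono_left (nhdsWithin_le_nhds (s := Set.Ioi 0))
        have hl' : l ∈ Set.Ioi (0 : ℝ) := hl
        simpa [oneSidedExp, hl'] using this
    have hn : ∀ y : ℝ, ∀ᵐ l, inner ℂ ((poissonMul y h - h) l) ((poissonMul y h - h) l) =
        (((‖oneSidedExp (-(2 * Real.pi * |y| : ℝ) : ℂ) l - 1‖ * ‖h l‖) ^ 2 : ℝ) : ℂ) := fun y => by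
      filter_upwards [hp y] with l h1
      rw [h1, inner_self_eq_norm_sq_to_K, norm_mul]
      simp
    simp_rw [fun y => integral_congr_ae (hn y)]
    refine tendsto_integral_filter_of_dominated_convergence (fun l => 4 * ‖h l‖ ^ 2)
      (Eventually.of_forall fun y => ?_) (Eventually.of_forall fun y => ?_) (hi.const_mul 4) hlim
    · exact (L2.integrable_inner _ _).aestronglyMeasurable.congr (hn y)
    · refine Eventually.of_forall fun l => ?_
      rw [Complex.norm_real, Real.norm_of_nonneg (by positivity), mul_pow]
      have h2 : ‖oneSidedExp (-(2 * Real.pi * |y| : ℝ) : ℂ) l - 1‖ ≤ 2 := by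
        refine (norm_sub_le _ _).trans ?_
        have := norm_oneSidedExp_le (decay_re_nonpos y) l
        rw [norm_one]
        linarith
      have h3 := pow_le_pow_left₀ (norm_nonneg _) h2 2
      gcongr
      linarith
  rw [integral_zero] at key
  have h4 := key.norm.sqrt
  simp only [norm_zero, Real.sqrt_zero] at h4
  refine h4.congr fun y => ?_
  rw [← L2.inner_def, inner_self_eq_norm_sq_to_K]
  simp

/-- The Paley–Wiener description of the Hardy space. -/
theorem mem_hardySpace_iff (f : L2R) :
    f ∈ hardySpace ↔ ∀ᵐ l, l < 0 → (𝓕 f : L2R) l = 0 := by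
  rw [mem_hardySpace_iff_tendsto]
  refine ⟨fun h => ?_, tendsto_poissonMul⟩
  have hm : MemLp ((Set.Iio (0 : ℝ)).indicator (1 : ℝ → ℂ)) ∞ volume :=
    memLp_top_of_bound ((measurable_one.indicator measurableSet_Iio).aestronglyMeasurable) 1
      (Eventually.of_forall fun x => (norm_indicator_le_norm_self _ _).trans (by simp))
  -- Vanishing on the negative half-line is a closed condition, so it passes to the limit.
  have h0 : ∀ y, mulL2 hm (poissonMul y (𝓕 f)) = 0 := fun y => by
    apply Lp.ext
    filter_upwards [mulL2_ae hm (poissonMul y (𝓕 f)), Lp.coeFn_zero ℂ 2 (volume : Measure ℝ),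
      mulL2_ae (memLp_top_oneSidedExp (decay_re_nonpos y)) (𝓕 f)] with l h1 h2 h3
    rw [h1, h2, poissonMul, h3, oneSidedExp]
    by_cases hl : l < 0
    · simp [hl.le]
    · simp [hl]
  have h5 := ((mulL2 hm).continuous.tendsto _).comp h
  have h6 : mulL2 hm (𝓕 f) = 0 :=
    tendsto_nhds_unique h5 (tendsto_const_nhds.congr fun y => (h0 y).symm)
  filter_upwards [mulL2_ae hm (𝓕 f), Lp.coeFn_zero ℂ 2 (volume : Measure ℝ)] with l h1 h2 hl
  rw [h6, h2] at h1
  simpa [hl] using h1.symm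

/-- Restriction of an `L²` function to the positive half-line. -/
noncomputable def halfLineRestrict : L2R →L[ℂ] L2R :=
  mulL2 (memLp_top_oneSidedExp (c := 0) le_rfl)

theorem halfLineRestrict_ae (h : L2R) :
    halfLineRestrict h =ᵐ[volume] fun l => (Set.Ioi (0 : ℝ)).indicator 1 l * h l := by
  filter_upwards [mulL2_ae (memLp_top_oneSidedExp (c := 0) le_rfl) h] with l hl
  rw [halfLineRestrict, hl]
  simp [oneSidedExp, Set.indicator_apply]

theorem fourierInv_halfLineRestrict_mem (h : L2R) : (𝓕⁻ (halfLineRestrict h) : L2R) ∈ hardySpace := by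
  rw [mem_hardySpace_iff, FourierTransform.fourier_fourierInv_eq]
  filter_upwards [halfLineRestrict_ae h] with l h1 hl
  rw [h1]
  simp [hl.le]

theorem inner_eq_zero_of_disjoint_halfLines {u v : L2R} (hu : ∀ᵐ l, l < 0 → u l = 0)
    (hv : ∀ᵐ l, 0 < l → v l = 0) : inner ℂ u v = 0 := by
  rw [L2.inner_def, ← integral_zero ℝ ℂ]
  refine integral_congr_ae ?_
  filter_upwards [hu, hv, Measure.ae_ne volume (0 : ℝ)] with l h1 h2 h3
  rcases lt_or_gt_of_ne h3 with hl | hl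
  · rw [h1 hl, inner_zero_left]
  · rw [h2 hl, inner_zero_right]

theorem sub_halfLineRestrict_ae (h : L2R) : ∀ᵐ l, 0 < l → (h - halfLineRestrict h) l = 0 := by
  filter_upwards [Lp.coeFn_sub h (halfLineRestrict h), halfLineRestrict_ae h] with l h1 h2 hl
  rw [h1, Pi.sub_apply, h2]
  simp [hl]

/-- Let `P` be restriction to the positive half-line and `h = 𝓕 f`. If `f ⟂ H²` then `⟨P h, h⟩ = 0`;
disjoint supports give `⟨P h, h - P h⟩ = 0`, hence `P h = 0`. -/
theorem mem_hardySpace_orthogonal_iff (f : L2R) :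
    f ∈ hardySpaceᗮ ↔ ∀ᵐ l, 0 < l → (𝓕 f : L2R) l = 0 := by
  rw [Submodule.mem_orthogonal]
  constructor
  · intro h
    have h1 := h _ (fourierInv_halfLineRestrict_mem (𝓕 f))
    have hm := fourierInv_halfLineRestrict_mem (𝓕 f)
    rw [mem_hardySpace_iff, FourierTransform.fourier_fourierInv_eq] at hm
    rw [← Lp.inner_fourier_eq, FourierTransform.fourier_fourierInv_eq] at h1
    have h2 := inner_eq_zero_of_disjoint_halfLines hm (sub_halfLineRestrict_ae (𝓕 f))
    rw [inner_sub_right, h1, zero_sub, neg_eq_zero, inner_self_eq_zero] at h2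
    filter_upwards [sub_halfLineRestrict_ae (𝓕 f)] with l h3 hl
    rw [h2, sub_zero] at h3
    exact h3 hl
  · intro h u hu
    rw [← Lp.inner_fourier_eq]
    exact inner_eq_zero_of_disjoint_halfLines ((mem_hardySpace_iff u).1 hu) h

theorem exists_add_hardySpace (f : L2R) :
    ∃ u ∈ hardySpace, ∃ v ∈ hardySpaceᗮ, u + v = f := by
  refine ⟨_, fourierInv_halfLineRestrict_mem (𝓕 f), 𝓕⁻ (𝓕 f - halfLineRestrict (𝓕 f)), ?_, ?_⟩
  · rw [mem_hardySpace_orthogonal_iff, FourierTransform.fourier_fourierInv_eq]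
    exact sub_halfLineRestrict_ae _
  · rw [← FourierTransform.fourierInv_add, add_sub_cancel,
      FourierTransform.fourierInv_fourier_eq]

theorem isCompl_hardySpace : IsCompl hardySpace hardySpaceᗮ := by
  refine ⟨Submodule.orthogonal_disjoint _, codisjoint_iff.2 (eq_top_iff.2 fun f _ => ?_)⟩
  obtain ⟨u, hu, v, hv, rfl⟩ := exists_add_hardySpace f
  exact Submodule.add_mem_sup hu hv

/-! ### Hardy scalars as Fourier multipliers, and the conclusion -/

theorem isFourierMultiplier_iff (T : L2R →L[ℂ] L2R) (m : ℝ → ℂ) :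
    IsFourierMultiplier T m ↔
      ∀ f : L2R, (𝓕 (T f) : L2R) =ᵐ[volume] fun x => m x * (𝓕 f : L2R) x := by
  refine ⟨fun h f => ?_, fun h f => ?_⟩
  · have := h (𝓕 f)
    rwa [FourierTransform.fourierInv_fourier_eq] at this
  · have := h (𝓕⁻ f)
    rwa [FourierTransform.fourier_fourierInv_eq] at this

theorem fourier_injective_L2 : Function.Injective fun f : L2R => (𝓕 f : L2R) :=
  (Lp.fourierTransformₗᵢ ℝ ℂ).injective

theorem isHardyScalar_iff_isFourierMultiplier (T : L2R →L[ℂ] L2R) (k₁ k₂ : ℂ) :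
    IsHardyScalar T k₁ k₂ ↔ IsFourierMultiplier T (fun x =>
      k₁ * (Set.Ioi (0 : ℝ)).indicator 1 x + k₂ * (Set.Iio (0 : ℝ)).indicator 1 x) := by
  rw [isFourierMultiplier_iff]
  constructor
  · rintro ⟨-, h1, h2⟩ f
    obtain ⟨u, hu, v, hv, rfl⟩ := exists_add_hardySpace f
    rw [map_add, h1 u hu, h2 v hv, FourierTransform.fourier_add, FourierTransform.fourier_add,
      FourierTransform.fourier_smul, FourierTransform.fourier_smul]
    filter_upwards [(mem_hardySpace_iff u).1 hu, (mem_hardySpace_orthogonal_iff v).1 hv,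
      Lp.coeFn_add (𝓕 u) (𝓕 v), Lp.coeFn_add (k₁ • 𝓕 u) (k₂ • 𝓕 v), Lp.coeFn_smul k₁ (𝓕 u),
      Lp.coeFn_smul k₂ (𝓕 v), Measure.ae_ne volume (0 : ℝ)] with l a1 a2 a3 a4 a5 a6 a7
    rw [a3, a4, Pi.add_apply, Pi.add_apply, a5, a6, Pi.smul_apply, Pi.smul_apply]
    rcases lt_or_gt_of_ne a7 with hl | hl
    · rw [a1 hl]; simp [hl, hl.le]
    · rw [a2 hl]; simp [hl, hl.le]
  · intro h
    refine ⟨isCompl_hardySpace, fun f hf => ?_, fun f hf => ?_⟩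
    all_goals
      apply fourier_injective_L2
      simp only [FourierTransform.fourier_smul]
      apply Lp.ext
    · filter_upwards [h f, (mem_hardySpace_iff f).1 hf, Lp.coeFn_smul k₁ (𝓕 f),
        Measure.ae_ne volume (0 : ℝ)] with l a1 a2 a3 a4
      rw [a1, a3, Pi.smul_apply]
      rcases lt_or_gt_of_ne a4 with hl | hl
      · rw [a2 hl]; simp
      · simp [hl, hl.le]
    · filter_upwards [h f, (mem_hardySpace_orthogonal_iff f).1 hf, Lp.coeFn_smul k₂ (𝓕 f),
        Measure.ae_ne volume (0 : ℝ)] with l a1 a2 a3 a4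
      rw [a1, a3, Pi.smul_apply]
      rcases lt_or_gt_of_ne a4 with hl | hl
      · simp [hl, hl.le]
      · rw [a2 hl]; simp

theorem mainTheorem2 (T : L2R →L[ℂ] L2R)
    (hT : ∀ g : Aff, T ∘L quasiRegular g = quasiRegular g ∘L T) :
    (∃ k₁ k₂ : ℂ, IsHardyScalar T k₁ k₂) ∧
      ∀ k₁ k₂ : ℂ, IsHardyScalar T k₁ k₂ ↔
        IsFourierMultiplier T (fun x =>
          k₁ * (Set.Ioi (0 : ℝ)).indicator 1 x + k₂ * (Set.Iio (0 : ℝ)).indicator 1 x) := by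
  refine ⟨?_, isHardyScalar_iff_isFourierMultiplier T⟩
  have hT' : ∀ g f, T (quasiRegular g f) = quasiRegular g (T f) := fun g f =>
    congrArg (fun S : L2R →L[ℂ] L2R => S f) (hT g)
  let M : L2R →L[ℂ] L2R := FourierTransform.fourierCLM ℂ L2R ∘L T ∘L
    FourierTransform.fourierInvCLM ℂ L2R
  have hM : ∀ h, M h = 𝓕 (T (𝓕⁻ h)) := fun h => rfl
  have hM' : ∀ f, M (𝓕 f) = 𝓕 (T f) := fun f => by
    rw [hM, FourierTransform.fourierInv_fourier_eq]
  obtain ⟨k₁, k₂, hk⟩ := exists_const_multiplier (M := M)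
    (fun b f => by
      rw [← FourierTransform.fourier_fourierInv_eq (F := L2R) f,
        ← fourier_quasiRegular_translation, hM', hM', hT', fourier_quasiRegular_translation])
    (fun a ha f => by
      -- Dilation by `a` on the Fourier side comes from dilation by `a⁻¹` on the original side.
      have e : (⟨a, 0, ha⟩ : Aff) = ⟨a⁻¹⁻¹, 0, inv_pos.2 (inv_pos.2 ha)⟩ := by ext <;> simp
      rw [e, ← FourierTransform.fourier_fourierInv_eq (F := L2R) f,
        ← fourier_quasiRegular_dilation (inv_pos.2 ha), hM', hM', hT',
        fourier_quasiRegular_dilation (inv_pos.2 ha)])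
  exact ⟨k₁, k₂, (isHardyScalar_iff_isFourierMultiplier T k₁ k₂).2 hk⟩
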